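/- Let $S^1=\{x\in\mathbb R^2:|x|=1\}$. For every arc $A\subseteq S^1$ (the set of points $(\cos t,\sin t)$ with $t$ in an interval of the real line, open, closed or half-open, containing more than one point) there exist a closed set $\Theta\subseteq A$ whose one-dimensional Lebesgue measure (arc length on $S^1$) is zero and a Borel probability measure $\sigma$ on $\mathbb R^2$ carried by $\Theta$, that is, $\sigma(\mathbb R^2\setminus\Theta)=0$, such that its Fourier transform $$\widehat\sigma(\xi)=\int_{\mathbb R^2} e^{-2\pi i\langle \xi,x\rangle}\,d\sigma(x),\qquad \xi\in\mathbb R^2,$$ satisfies $\widehat\sigma(\xi)\to 0$ as $|\xi|\to\infty$. -/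

import Mathlib

open Real Set Filter Topology MeasureTheory

/-- The Euclidean plane ℝ². -/
abbrev Plane : Type := EuclideanSpace ℝ (Fin 2)

noncomputable section

/-- The point of the unit circle with angle `t`. -/
def circlePoint (t : ℝ) : Plane := !₂[Real.cos t, Real.sin t]

theorem continuous_circlePoint : Continuous circlePoint := by
  unfold circlePoint
  refine (PiLp.continuous_toLp 2 _).comp (continuous_pi fun i => ?_)
  fin_cases i
  · exact Real.continuous_cos
  · exact Real.continuous_sin

/-- An arc of the unit circle: the points whose angles run through an interval of the line
(open, closed or half-open, bounded or not) with more than one point. -/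
def IsArc (A : Set Plane) : Prop :=
  ∃ I : Set ℝ, I.OrdConnected ∧ I.Nontrivial ∧ A = circlePoint '' I

/-- One-dimensional Lebesgue measure (arc length) on the unit circle, as a measure on the plane:
the image of Lebesgue measure on `[0, 2π)` under the parametrization by the angle. -/
def arcLength : Measure Plane :=
  (volume.restrict (Ico (0 : ℝ) (2 * π))).map circlePoint

/-- The Fourier transform `ξ ↦ ∫ exp(-2πi⟨ξ, x⟩) dσ(x)` of a finite measure on the plane. -/
def measureFourier (σ : Measure Plane) (ξ : Plane) : ℂ :=
  ∫ x, Complex.exp (-2 * (π : ℂ) * Complex.I * ((inner ℝ ξ x : ℝ) : ℂ)) ∂σ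

end

noncomputable section

local notation "𝕋" => AddCircle (2 * π)

/-! The measure is a weak limit of Riesz-type products. Start from a bump `p₀` supported in the arc
and multiply successively by `h (n_k x)`, where `h ≥ 0` has mean one and lives on the cap `{cos ≥
1/2}`. If `n_k` grows fast enough, each factor changes the Fourier transform by at most `2⁻ᵏ/4`
uniformly in the frequency. Every continuous density has a transform tending to zero, so the uniform
limit does too. The supports shrink to a closed set on which all `cos (n_k x) ≥ 1/2`, and this set
is null.

The uniform estimate (`tendsto_osc_centeredDilate`) is where the curvature of the circle enters. For
exponentials `f = e_m`, `h = e_k` with `k ≠ 0`, it says that the Bessel function of order `m + nk`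
tends to zero as `n → ∞`, uniformly in its argument (`tendsto_osc_fourier_order`). Large arguments
are handled by decay uniform in the order, bounded arguments by integration by parts. Density of
trigonometric polynomials does the rest. -/

instance fact_two_pi_pos : Fact (0 < 2 * π) := ⟨Real.two_pi_pos⟩

/-! ### Integration and plane waves on the circle -/

/-- Integration of continuous functions on the circle `ℝ / 2πℤ`. -/
def circleInt : C(AddCircle (2 * π), ℂ) →ₗ[ℂ] ℂ where
  toFun f := ∫ x, f x
  map_add' f g := integral_add (f.continuous.integrable_of_hasCompactSupport
    (HasCompactSupport.of_compactSpace _)) (g.continuous.integrable_of_hasCompactSupport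
    (HasCompactSupport.of_compactSpace _))
  map_smul' c _ := integral_const_mul c _

local notation "𝓘" => circleInt

theorem circleInt_apply (f : C(𝕋, ℂ)) : 𝓘 f = ∫ x, f x := rfl

theorem integrable_circle {E : Type*} [NormedAddCommGroup E] (f : C(𝕋, E)) :
    Integrable f :=
  f.continuous.integrable_of_hasCompactSupport (HasCompactSupport.of_compactSpace _)

theorem volume_real_circle : (volume : Measure 𝕋).real univ = 2 * π := by
  simp [Measure.real, AddCircle.measure_univ, Real.pi_pos.le]

theorem norm_circleInt_le (f : C(𝕋, ℂ)) : ‖𝓘 f‖ ≤ 2 * π * ‖f‖ := by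
  have := norm_integral_le_of_norm_le_const (μ := (volume : Measure 𝕋)) (f := f)
    (Eventually.of_forall f.norm_coe_le_norm)
  rw [volume_real_circle] at this
  rw [circleInt_apply]; linarith

/-- The plane wave `x ↦ exp (i Re (z e^{ix}))` on the circle. -/
def wave (z : ℂ) : C(𝕋, ℂ) where
  toFun x := Complex.exp (((z * fourier 1 x).re : ℂ) * Complex.I)
  continuous_toFun := by fun_prop

theorem wave_apply (z : ℂ) (x : 𝕋) :
    wave z x = Complex.exp (((z * fourier 1 x).re : ℂ) * Complex.I) := rfl

theorem norm_wave_apply (z : ℂ) (x : 𝕋) : ‖wave z x‖ = 1 := Complex.norm_exp_ofReal_mul_I _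

theorem norm_wave_le (z : ℂ) : ‖wave z‖ ≤ 1 :=
  (ContinuousMap.norm_le _ zero_le_one).2 fun x => (norm_wave_apply z x).le

theorem wave_zero : wave 0 = 1 := by
  ext x; simp [wave_apply]

theorem wave_add (z w : ℂ) : wave (z + w) = wave z * wave w := by
  ext x; simp [wave_apply, add_mul, Complex.exp_add]

theorem conj_wave_apply (z : ℂ) (x : 𝕋) :
    (starRingEnd ℂ) (wave z x) = wave (-z) x := by
  rw [wave_apply, ← Complex.exp_conj, wave_apply]
  congr 1
  simp
  ring

theorem fourier_add_arg (n : ℤ) (x y : 𝕋) :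
    (fourier n (x + y) : ℂ) = fourier n x * fourier n y := by
  simp [fourier_apply, smul_add, AddCircle.toCircle_add]

theorem wave_apply_add (z : ℂ) (x y : 𝕋) : wave z (x + y) = wave (z * fourier 1 y) x := by
  rw [wave_apply, wave_apply, fourier_add_arg]; ring_nf

theorem norm_fourier_apply (n : ℤ) (x : 𝕋) : ‖(fourier n x : ℂ)‖ = 1 := by
  rw [fourier_apply, Circle.norm_coe]

/-- The Fourier transform of the density `f` on the unit circle. -/
def osc (f : C(𝕋, ℂ)) (z : ℂ) : ℂ := 𝓘 (f * wave z)

theorem osc_apply (f : C(𝕋, ℂ)) (z : ℂ) : osc f z = ∫ x, f x * wave z x := rfl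

theorem norm_osc_le (f : C(𝕋, ℂ)) (z : ℂ) : ‖osc f z‖ ≤ 2 * π * ‖f‖ := by
  refine (norm_circleInt_le _).trans ?_
  gcongr
  refine (norm_mul_le _ _).trans ?_
  have := norm_wave_le z
  nlinarith [norm_nonneg f]

theorem continuous_osc (f : C(𝕋, ℂ)) : Continuous (osc f) := by
  refine continuous_of_dominated (F := fun z x => f x * wave z x) (bound := fun x => ‖f‖) ?_ ?_ ?_ ?_
  · exact fun z => (integrable_circle (f * wave z)).aestronglyMeasurable
  · refine fun z => Eventually.of_forall fun x => ?_
    rw [norm_mul, norm_wave_apply, mul_one]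
    exact f.norm_coe_le_norm x
  · exact integrable_const _
  · refine Eventually.of_forall fun x => ?_
    simp only [wave_apply]
    fun_prop

theorem integral_circle_eq {E : Type*} [NormedAddCommGroup E] [NormedSpace ℝ E] (f : 𝕋 → E) :
    ∫ x, f x = ∫ t in (0 : ℝ)..2 * π, f (t : 𝕋) := by
  have := AddCircle.intervalIntegral_preimage (2 * π) 0 f
  rw [zero_add] at this
  exact this.symm

theorem fourier_coe_two_pi (n : ℤ) (t : ℝ) :
    (fourier n (t : 𝕋) : ℂ) = Complex.exp ((n * t : ℂ) * Complex.I) := by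
  rw [fourier_coe_apply]
  congr 1
  have : (π : ℂ) ≠ 0 := by exact_mod_cast Real.pi_ne_zero
  push_cast
  field_simp

/-! ### Decay of Bessel functions in the argument and in the order -/

/-- The derivative of `F = e^{imx} wave z` is `i (m + G) F` with `|G| ≤ ‖z‖`. Its integral over a
period vanishes, so `m ∫ F = -∫ G F`. -/
theorem abs_mul_norm_osc_fourier_le (m : ℤ) (z : ℂ) :
    |(m : ℝ)| * ‖osc (fourier m) z‖ ≤ 2 * π * ‖z‖ := by
  set G : C(𝕋, ℂ) :=
    ⟨fun x => (((Complex.I * z * fourier 1 x).re : ℝ) : ℂ), by fun_prop⟩ with hG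
  have hder : ∀ t : ℝ, HasDerivAt (fun t : ℝ => ((fourier m * wave z : C(𝕋, ℂ)) (t : 𝕋)))
      (Complex.I * ((m : ℂ) + G (t : 𝕋)) * (fourier m * wave z : C(𝕋, ℂ)) (t : 𝕋)) t := by
    intro t
    have h1 : HasDerivAt (fun t : ℝ => (z * fourier 1 (t : 𝕋) : ℂ))
        (Complex.I * z * fourier 1 (t : 𝕋)) t := by
      simp only [fourier_coe_two_pi]
      have h := (((Complex.ofRealCLM.hasDerivAt (x := t)).const_mul ((1 : ℤ) : ℂ)).mul_const
        Complex.I).cexp.const_mul z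
      refine h.congr_deriv ?_
      simp only [Complex.ofRealCLM_apply, Complex.ofReal_one, Int.cast_one]
      ring
    have h2 := (Complex.reCLM.hasFDerivAt.comp_hasDerivAt t h1)
    have h3 := (Complex.ofRealCLM.hasFDerivAt.comp_hasDerivAt t h2).mul_const Complex.I
    have h4 := (((Complex.ofRealCLM.hasDerivAt (x := t)).const_mul (m : ℂ)).mul_const
        Complex.I)
    have h5 := (h4.add h3).cexp
    convert h5 using 1
    · ext s
      rw [ContinuousMap.mul_apply, fourier_coe_two_pi, wave_apply, ← Complex.exp_add]
      rfl
    · rw [ContinuousMap.mul_apply, fourier_coe_two_pi, wave_apply, ← Complex.exp_add, mul_comm]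
      congr 1
      simp only [hG, ContinuousMap.coe_mk, Complex.ofRealCLM_apply, Complex.reCLM_apply,
        Complex.ofReal_one]
      ring
  have hint := intervalIntegral.integral_eq_sub_of_hasDerivAt (a := 0) (b := 2 * π)
    (fun t _ => hder t) (Continuous.intervalIntegrable (by
      have := AddCircle.continuous_mk' (2 * π)
      fun_prop) _ _)
  have hper : ((2 * π : ℝ) : 𝕋) = ((0 : ℝ) : 𝕋) := by simp [AddCircle.coe_period]
  rw [hper, sub_self, ← integral_circle_eq (fun x : 𝕋 => Complex.I * ((m : ℂ) + G x) *
    (fourier m * wave z : C(𝕋, ℂ)) x)] at hint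
  have hsum : (m : ℂ) * osc (fourier m) z = - 𝓘 (G * (fourier m * wave z)) := by
    have : 𝓘 (Complex.I • ((m : ℂ) • (fourier m * wave z) + G * (fourier m * wave z))) = 0 := by
      rw [← hint, circleInt_apply]
      congr 1; ext x; simp; ring
    rw [map_smul, map_add, map_smul] at this
    have h0 := (smul_eq_zero.1 this).resolve_left Complex.I_ne_zero
    rw [osc, ← smul_eq_mul]
    exact eq_neg_of_add_eq_zero_left h0
  calc |(m : ℝ)| * ‖osc (fourier m) z‖ = ‖(m : ℂ) * osc (fourier m) z‖ := by
        rw [norm_mul]; simp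
    _ = ‖𝓘 (G * (fourier m * wave z))‖ := by rw [hsum, norm_neg]
    _ ≤ 2 * π * ‖G * (fourier m * wave z)‖ := norm_circleInt_le _
    _ ≤ 2 * π * ‖z‖ := by
        gcongr
        refine (ContinuousMap.norm_le _ (norm_nonneg _)).2 fun x => ?_
        simp only [ContinuousMap.mul_apply, norm_mul, norm_fourier_apply, norm_wave_apply, mul_one]
        simp only [hG, ContinuousMap.coe_mk, Complex.norm_real]
        refine (Complex.abs_re_le_norm _).trans ?_
        simp [-fourier_apply, norm_fourier_apply]

/-- Multiplying `z` by a unimodular number translates the wave, and the integral is translation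
invariant. -/
theorem osc_one_eq_norm (z : ℂ) : osc 1 z = osc 1 (‖z‖ : ℂ) := by
  have hz : z = (‖z‖ : ℂ) * fourier 1 ((Complex.arg z : ℝ) : 𝕋) := by
    rw [fourier_coe_two_pi]
    simp [Complex.norm_mul_exp_arg_mul_I]
  conv_lhs => rw [hz]
  simp only [osc_apply, ContinuousMap.one_apply, one_mul, ← wave_apply_add]
  exact integral_add_right_eq_self (fun x => wave (‖z‖ : ℂ) x) _

/-- The substitution `u = cos t` gives the Fourier integral of `1 / √(1 - u²)` on `(-1, 1)`, to
which the Riemann–Lebesgue lemma applies. -/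
theorem tendsto_integral_exp_cos :
    Tendsto (fun r : ℝ => ∫ t in (0 : ℝ)..π, Complex.exp ((r * Real.cos t : ℝ) * Complex.I))
      (cocompact ℝ) (𝓝 0) := by
  have hRL := Real.tendsto_integral_exp_smul_cocompact
    ((Ioo (-1 : ℝ) 1).indicator fun u => ((|-(1 / √(1 - u ^ 2))| : ℝ) : ℂ))
  -- The rescaling turns the character `e^{-2πiuw}` into `e^{iru}`.
  have hscale : Tendsto (fun r : ℝ => -(2 * π)⁻¹ * r) (cocompact ℝ) (cocompact ℝ) :=
    (Homeomorph.mulLeft₀ _ (by simp [Real.pi_ne_zero])).isClosedEmbedding.tendsto_cocompact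
  refine (hRL.comp hscale).congr fun r => ?_
  have himg : Real.arccos '' Ioo (-1) 1 = Ioo 0 π := by
    ext t
    constructor
    · rintro ⟨u, hu, rfl⟩
      refine ⟨Real.arccos_pos.2 hu.2, lt_of_le_of_ne (Real.arccos_le_pi _) fun h => ?_⟩
      exact absurd (Real.arccos_eq_pi.1 h) (not_le.2 hu.1)
    · intro ht
      refine ⟨Real.cos t, ⟨?_, ?_⟩, Real.arccos_cos ht.1.le ht.2.le⟩
      · rw [← Real.cos_pi]
        exact Real.cos_lt_cos_of_nonneg_of_le_pi ht.1.le le_rfl ht.2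
      · rw [← Real.cos_zero]
        exact Real.cos_lt_cos_of_nonneg_of_le_pi le_rfl ht.2.le ht.1
  rw [intervalIntegral.integral_of_le Real.pi_pos.le, integral_Ioc_eq_integral_Ioo, ← himg,
    integral_image_eq_integral_abs_deriv_smul measurableSet_Ioo
      (fun u hu => (Real.hasDerivAt_arccos hu.1.ne' hu.2.ne).hasDerivWithinAt)
      (Real.arccos_injOn.mono Ioo_subset_Icc_self), Function.comp,
    ← integral_indicator measurableSet_Ioo]
  congr 1; ext u
  by_cases hu : u ∈ Ioo (-1 : ℝ) 1
  · rw [indicator_of_mem hu, indicator_of_mem hu, Real.cos_arccos hu.1.le hu.2.le,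
      Circle.smul_def, Real.fourierChar_apply]
    simp only [smul_eq_mul, Complex.real_smul]
    rw [mul_comm]
    congr 3
    have := Real.pi_ne_zero
    field_simp
  · rw [indicator_of_notMem hu, indicator_of_notMem hu, smul_zero]

theorem osc_one_ofReal (r : ℝ) : osc 1 (r : ℂ) =
    (∫ t in (0 : ℝ)..π, Complex.exp ((r * Real.cos t : ℝ) * Complex.I)) +
      ∫ t in (0 : ℝ)..π, Complex.exp ((-r * Real.cos t : ℝ) * Complex.I) := by
  have hval : ∀ t : ℝ, (1 : C(𝕋, ℂ)) (t : 𝕋) * wave r (t : 𝕋) =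
      Complex.exp ((r * Real.cos t : ℝ) * Complex.I) := by
    intro t
    rw [wave_apply, fourier_coe_two_pi]
    simp [Complex.exp_ofReal_mul_I_re]
  have hc : Continuous fun t : ℝ => Complex.exp ((r * Real.cos t : ℝ) * Complex.I) := by fun_prop
  rw [osc_apply, integral_circle_eq]
  simp only [hval]
  rw [← intervalIntegral.integral_add_adjacent_intervals (b := π) (hc.intervalIntegrable _ _)
    (hc.intervalIntegrable _ _)]
  congr 1
  have := intervalIntegral.integral_comp_add_right (a := 0) (b := π)
    (fun t : ℝ => Complex.exp ((r * Real.cos t : ℝ) * Complex.I)) π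
  rw [zero_add, ← two_mul] at this
  rw [← this]
  simp [Real.cos_add_pi]

theorem tendsto_osc_one : Tendsto (osc 1) (Bornology.cobounded ℂ) (𝓝 0) := by
  have h1 : Tendsto (fun r : ℝ => osc 1 (r : ℂ)) atTop (𝓝 0) := by
    simp only [osc_one_ofReal]
    have ht : Tendsto (fun r : ℝ => r) atTop (cocompact ℝ) := by
      rw [cocompact_eq_atBot_atTop]; exact tendsto_id.mono_right le_sup_right
    have ht' : Tendsto (fun r : ℝ => -r) atTop (cocompact ℝ) := by
      rw [cocompact_eq_atBot_atTop]; exact tendsto_neg_atTop_atBot.mono_right le_sup_left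
    simpa using (tendsto_integral_exp_cos.comp ht).add (tendsto_integral_exp_cos.comp ht')
  refine (h1.comp tendsto_norm_cobounded_atTop).congr fun z => ?_
  exact (osc_one_eq_norm z).symm

/-- Expand `|∫ F|²` as the double integral of `conj F(y) F(y + s)`. For fixed `s` the order enters
only through the unimodular constant `e^{ims}`, so the bound is independent of `m`. -/
theorem norm_osc_fourier_sq_le (m : ℤ) (z : ℂ) :
    ‖osc (fourier m) z‖ ^ 2 ≤ ∫ s : 𝕋, ‖osc 1 (z * (fourier 1 s - 1))‖ := by
  set F : C(𝕋, ℂ) := fourier m * wave z with hF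
  have hFF : ∀ y s : 𝕋, (starRingEnd ℂ) (F y) * F (y + s) =
      fourier m s * wave (z * (fourier 1 s - 1)) y := by
    intro y s
    have h1 : (starRingEnd ℂ) (fourier m y) * fourier m y = (1 : ℂ) := by
      rw [Complex.conj_mul', norm_fourier_apply]; simp
    have h2 : wave (z * (fourier 1 s - 1)) y = wave (z * fourier 1 s) y * wave (-z) y := by
      rw [← ContinuousMap.mul_apply, ← wave_add]; ring_nf
    rw [h2]
    simp only [hF, ContinuousMap.mul_apply, map_mul, conj_wave_apply, fourier_add_arg,
      wave_apply_add]
    linear_combination (fourier m s * wave (z * fourier 1 s) y * wave (-z) y) * h1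
  have key : (starRingEnd ℂ) (osc (fourier m) z) * osc (fourier m) z =
      ∫ s : 𝕋, fourier m s * osc 1 (z * (fourier 1 s - 1)) := by
    calc (starRingEnd ℂ) (osc (fourier m) z) * osc (fourier m) z
        = (∫ y, (starRingEnd ℂ) (F y)) * ∫ x, F x := by
          rw [integral_conj]; rfl
      _ = ∫ y, ∫ s, (starRingEnd ℂ) (F y) * F (y + s) := by
          rw [← integral_mul_const]
          congr 1; ext y
          rw [integral_const_mul, integral_add_left_eq_self (fun x => F x)]
      _ = ∫ s, ∫ y, (starRingEnd ℂ) (F y) * F (y + s) := by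
          refine integral_integral_swap_of_hasCompactSupport ?_ (HasCompactSupport.of_compactSpace _)
          simp only [Function.uncurry_def]
          fun_prop
      _ = _ := by
          congr 1; ext s
          simp only [hFF, osc_apply, ContinuousMap.one_apply, one_mul]
          exact integral_const_mul _ _
  calc ‖osc (fourier m) z‖ ^ 2 = ‖(starRingEnd ℂ) (osc (fourier m) z) * osc (fourier m) z‖ := by
        rw [norm_mul, RCLike.norm_conj, sq]
    _ = ‖∫ s : 𝕋, fourier m s * osc 1 (z * (fourier 1 s - 1))‖ := by rw [key]
    _ ≤ ∫ s : 𝕋, ‖(fourier m s : ℂ) * osc 1 (z * (fourier 1 s - 1))‖ :=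
        norm_integral_le_integral_norm _
    _ = _ := by simp only [norm_mul, norm_fourier_apply, one_mul]

theorem fourier_one_ne_one {s : 𝕋} (hs : s ≠ 0) : (fourier 1 s : ℂ) ≠ 1 := by
  rw [fourier_one]
  intro h
  refine hs (AddCircle.injective_toCircle (Real.two_pi_pos.ne') (Circle.ext ?_))
  rw [h, AddCircle.toCircle_zero, Circle.coe_one]

theorem volume_singleton_circle (x : 𝕋) : volume {x} = 0 := by
  rw [← Metric.closedBall_zero, AddCircle.volume_closedBall]
  simp [Real.pi_pos.le]

/-- Dominated convergence: for every `s ≠ 0` the argument `z (e^{is} - 1)` goes to infinity with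
`z`. -/
theorem tendsto_integral_norm_osc_one :
    Tendsto (fun z : ℂ => ∫ s : 𝕋, ‖osc 1 (z * (fourier 1 s - 1))‖)
      (Bornology.cobounded ℂ) (𝓝 0) := by
  have : (Bornology.cobounded ℂ).IsCountablyGenerated := by
    rw [← comap_norm_atTop]; infer_instance
  have := tendsto_integral_filter_of_dominated_convergence (μ := (volume : Measure 𝕋))
    (l := Bornology.cobounded ℂ) (F := fun z s => ‖osc 1 (z * (fourier 1 s - 1))‖)
    (f := fun _ => (0 : ℝ)) (fun _ => 2 * π * ‖(1 : C(𝕋, ℂ))‖) ?_ ?_ (integrable_const _) ?_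
  · simpa using this
  · refine Eventually.of_forall fun z => Continuous.aestronglyMeasurable ?_
    have := continuous_osc 1
    fun_prop
  · refine Eventually.of_forall fun z => Eventually.of_forall fun s => ?_
    rw [norm_norm]
    exact norm_osc_le _ _
  · filter_upwards [compl_mem_ae_iff.2 (volume_singleton_circle 0)] with s hs
    have h0 : (fourier 1 s : ℂ) - 1 ≠ 0 := sub_ne_zero.2 (fourier_one_ne_one hs)
    have ht : Tendsto (fun z : ℂ => z * ((fourier 1 s : ℂ) - 1)) (Bornology.cobounded ℂ)
        (Bornology.cobounded ℂ) := by
      rw [← tendsto_norm_atTop_iff_cobounded]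
      simp only [norm_mul]
      exact tendsto_norm_cobounded_atTop.atTop_mul_const (norm_pos_iff.2 h0)
    simpa using (tendsto_osc_one.comp ht).norm

/-- The Bessel functions `J_m` tend to zero at infinity uniformly in the order. -/
theorem tendsto_osc_fourier_cobounded :
    Tendsto (fun p : ℤ × ℂ => osc (fourier p.1) p.2) (⊤ ×ˢ Bornology.cobounded ℂ) (𝓝 0) := by
  have h : Tendsto (fun p : ℤ × ℂ => √(∫ s : 𝕋, ‖osc 1 (p.2 * (fourier 1 s - 1))‖))
      (⊤ ×ˢ Bornology.cobounded ℂ) (𝓝 0) := by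
    have := (Real.continuous_sqrt.tendsto 0).comp
      (tendsto_integral_norm_osc_one.comp (tendsto_snd (f := (⊤ : Filter ℤ))))
    rwa [Real.sqrt_zero] at this
  exact squeeze_zero_norm (fun p => Real.le_sqrt_of_sq_le (norm_osc_fourier_sq_le p.1 p.2)) h

/-- The Bessel functions `J_m` tend to zero with the order, uniformly in the argument. -/
theorem tendsto_osc_fourier_order :
    Tendsto (fun p : ℤ × ℂ => osc (fourier p.1) p.2) (cofinite ×ˢ ⊤) (𝓝 0) := by
  rw [Metric.tendsto_nhds]
  intro ε hε
  have h := (Metric.tendsto_nhds.1 tendsto_osc_fourier_cobounded ε hε)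
  rw [eventually_prod_iff] at h
  obtain ⟨pa, hpa, pb, hpb, h⟩ := h
  rw [eventually_top] at hpa
  obtain ⟨R, -, hR⟩ := (Metric.hasBasis_cobounded_compl_closedBall (0 : ℂ)).eventually_iff.1 hpb
  -- For `‖z‖ > R` the decay uniform in the order suffices; for `‖z‖ ≤ R` the bound `2π‖z‖ / |m|` is
  -- below `ε` once `|m|` passes this threshold.
  have hbig : ∀ᶠ m : ℤ in cofinite, 2 * π * max R 0 / ε < |(m : ℝ)| := by
    have : Tendsto (fun m : ℤ => ‖(m : ℝ)‖) cofinite atTop :=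
      tendsto_norm_cocompact_atTop.comp Int.tendsto_coe_cofinite
    exact this.eventually_gt_atTop _
  refine (hbig.prod_mk (eventually_top.2 fun _ => trivial)).mono ?_
  rintro ⟨m, z⟩ ⟨hm, -⟩
  by_cases hz : z ∈ (Metric.closedBall (0 : ℂ) R)ᶜ
  · exact h (hpa m) (hR hz)
  · have hz' : ‖z‖ ≤ R := by simpa using hz
    rw [dist_zero_right]
    have h1 := abs_mul_norm_osc_fourier_le m z
    by_contra! hcon
    simp only at hm hcon
    rw [div_lt_iff₀ hε] at hm
    have h2 : |(m : ℝ)| * ε ≤ |(m : ℝ)| * ‖osc (fourier m) z‖ := by gcongr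
    have h3 : 2 * π * ‖z‖ ≤ 2 * π * max R 0 := by gcongr; exact hz'.trans (le_max_left _ _)
    linarith

/-! ### Reduction to exponentials, and decay for continuous densities -/

/-- Trigonometric polynomials are dense and the functionals are equibounded, so convergence on
exponentials passes to all continuous functions. Since the index may include the frequency, this
also yields uniform statements. -/
theorem tendsto_zero_of_tendsto_fourier {ι : Type*} {l : Filter ι} (Φ : ι → C(𝕋, ℂ) →ₗ[ℂ] ℂ)
    (C : ℝ) (hC : ∀ i f, ‖Φ i f‖ ≤ C * ‖f‖)
    (h : ∀ n, Tendsto (fun i => Φ i (fourier n)) l (𝓝 0)) (f : C(𝕋, ℂ)) :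
    Tendsto (fun i => Φ i f) l (𝓝 0) := by
  have hspan : ∀ g ∈ Submodule.span ℂ (range (@fourier (2 * π))),
      Tendsto (fun i => Φ i g) l (𝓝 0) := by
    intro g hg
    induction hg using Submodule.span_induction with
    | mem g hg => obtain ⟨n, rfl⟩ := hg; exact h n
    | zero => simpa using tendsto_const_nhds
    | add f g _ _ hf hg => simpa using hf.add hg
    | smul c f _ hf => simpa using hf.const_mul c
  have hf : f ∈ closure (Submodule.span ℂ (range (@fourier (2 * π))) : Set C(𝕋, ℂ)) := by
    rw [← Submodule.topologicalClosure_coe, span_fourier_closure_eq_top]; trivial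
  rw [Metric.tendsto_nhds]
  intro ε hε
  obtain ⟨g, hg, hfg⟩ := Metric.mem_closure_iff.1 hf (ε / (2 * (|C| + 1))) (by positivity)
  filter_upwards [Metric.tendsto_nhds.1 (hspan g hg) (ε / 2) (by positivity)] with i hi
  rw [dist_zero_right] at hi ⊢
  rw [dist_eq_norm] at hfg
  have h1 : ‖Φ i (f - g)‖ ≤ ε / 2 := by
    calc ‖Φ i (f - g)‖ ≤ C * ‖f - g‖ := hC _ _
      _ ≤ (|C| + 1) * (ε / (2 * (|C| + 1))) := by
          gcongr
          linarith [le_abs_self C]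
      _ = ε / 2 := by field_simp
  calc ‖Φ i f‖ = ‖Φ i (f - g) + Φ i g‖ := by rw [← map_add, sub_add_cancel]
    _ ≤ ‖Φ i (f - g)‖ + ‖Φ i g‖ := norm_add_le _ _
    _ < ε := by linarith

/-- Pairing with a continuous function by integration. -/
def pairing (g : C(𝕋, ℂ)) : C(𝕋, ℂ) →ₗ[ℂ] ℂ := 𝓘 ∘ₗ LinearMap.mulRight ℂ g

theorem pairing_apply (g f : C(𝕋, ℂ)) : pairing g f = 𝓘 (f * g) := rfl

theorem osc_eq_pairing (f : C(𝕋, ℂ)) (z : ℂ) : osc f z = pairing (wave z) f := rfl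

theorem norm_pairing_le {g : C(𝕋, ℂ)} (hg : ‖g‖ ≤ 1) (f : C(𝕋, ℂ)) :
    ‖pairing g f‖ ≤ 2 * π * ‖f‖ := by
  refine (norm_circleInt_le _).trans ?_
  gcongr
  refine (norm_mul_le _ _).trans ?_
  nlinarith [norm_nonneg f]

/-- Continuous densities on the unit circle are Rajchman. -/
theorem tendsto_osc (f : C(𝕋, ℂ)) : Tendsto (osc f) (Bornology.cobounded ℂ) (𝓝 0) := by
  have h : ∀ n : ℤ, Tendsto (fun z : ℂ => pairing (wave z) (fourier n)) (Bornology.cobounded ℂ)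
      (𝓝 0) := by
    intro n
    have ht : Tendsto (fun z : ℂ => (n, z)) (Bornology.cobounded ℂ)
        ((⊤ : Filter ℤ) ×ˢ Bornology.cobounded ℂ) :=
      Tendsto.prodMk tendsto_top tendsto_id
    refine (tendsto_osc_fourier_cobounded.comp ht).congr fun z => ?_
    rw [Function.comp_apply, osc_eq_pairing]
  have hb : ∀ (z : ℂ) (g : C(𝕋, ℂ)), ‖pairing (wave z) g‖ ≤ 2 * π * ‖g‖ :=
    fun z g => norm_pairing_le (norm_wave_le z) g
  refine (tendsto_zero_of_tendsto_fourier _ _ hb h f).congr fun z => ?_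
  rw [osc_eq_pairing]

/-! ### Multiplication by a dilated function -/

theorem fourier_add_eq (m n : ℤ) : (fourier (m + n) : C(𝕋, ℂ)) = fourier m * fourier n := by
  ext x; exact fourier_add

/-- The function `x ↦ f (n x)`. -/
def dilate {E : Type*} [TopologicalSpace E] (n : ℕ) (f : C(𝕋, E)) : C(𝕋, E) :=
  f.comp ⟨fun x => n • x, by fun_prop⟩

theorem dilate_apply {E : Type*} [TopologicalSpace E] (n : ℕ) (f : C(𝕋, E)) (x : 𝕋) :
    dilate n f x = f (n • x) := rfl

theorem dilate_fourier (n : ℕ) (k : ℤ) : dilate n (fourier k : C(𝕋, ℂ)) = fourier (n * k) := by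
  ext x
  have h : k • (n • x) = ((n : ℤ) * k) • x := by
    rw [← natCast_zsmul, smul_smul, mul_comm k]
  rw [dilate_apply, fourier_apply, fourier_apply, h]

theorem norm_dilate_le (n : ℕ) (f : C(𝕋, ℂ)) : ‖dilate n f‖ ≤ ‖f‖ :=
  (ContinuousMap.norm_le _ (norm_nonneg _)).2 fun _ => f.norm_coe_le_norm _

/-- Dilations of the mean-zero part of a function. -/
def centeredDilate (n : ℕ) : C(𝕋, ℂ) →ₗ[ℂ] C(𝕋, ℂ) where
  toFun h := dilate n h - ((2 * π : ℂ)⁻¹ * 𝓘 h) • 1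
  map_add' f g := by
    ext x; simp [dilate_apply]; ring
  map_smul' c f := by
    ext x; simp [dilate_apply]; ring

theorem centeredDilate_apply (n : ℕ) (h : C(𝕋, ℂ)) :
    centeredDilate n h = dilate n h - ((2 * π : ℂ)⁻¹ * 𝓘 h) • 1 := rfl

theorem norm_centeredDilate_le (n : ℕ) (h : C(𝕋, ℂ)) : ‖centeredDilate n h‖ ≤ 2 * ‖h‖ := by
  rw [centeredDilate_apply]
  have h1 := norm_dilate_le n h
  have h2 : ‖((2 * π : ℂ)⁻¹ * 𝓘 h) • (1 : C(𝕋, ℂ))‖ ≤ ‖h‖ := by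
    rw [norm_smul, norm_one, mul_one, norm_mul]
    have := norm_circleInt_le h
    have h3 : ‖(2 * π : ℂ)⁻¹‖ = (2 * π)⁻¹ := by
      simp [abs_of_pos Real.pi_pos]
    rw [h3, inv_mul_le_iff₀ Real.two_pi_pos]
    exact this
  linarith [norm_sub_le (dilate n h) (((2 * π : ℂ)⁻¹ * 𝓘 h) • (1 : C(𝕋, ℂ)))]

/-- This is the integration by parts bound at `z = 0`. -/
theorem circleInt_fourier {k : ℤ} (hk : k ≠ 0) : 𝓘 (fourier k) = 0 := by
  have := abs_mul_norm_osc_fourier_le k 0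
  rw [osc, wave_zero, mul_one, norm_zero, mul_zero] at this
  have hk' : 0 < |(k : ℝ)| := by simpa using hk
  exact norm_le_zero_iff.1 (nonpos_of_mul_nonpos_right this hk')

/-- Multiplying a density by `h (n x)`, with `h` of mean `c`, changes its Fourier transform,
uniformly and up to a vanishing error, by the factor `c`. -/
theorem tendsto_osc_centeredDilate (f h : C(𝕋, ℂ)) :
    Tendsto (fun p : ℕ × ℂ => osc (f * centeredDilate p.1 h) p.2) (atTop ×ˢ ⊤) (𝓝 0) := by
  -- The density argument is used twice, first in `h`, then in `f`. For `h = e_0` the centered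
  -- dilate is zero; for `h = e_k`, `k ≠ 0`, and `f = e_m` the order `m + nk` leaves every finite
  -- set.
  refine tendsto_zero_of_tendsto_fourier
    (fun p : ℕ × ℂ => pairing (f * wave p.2) ∘ₗ centeredDilate p.1) (2 * π * ‖f‖ * 2)
    (fun p h => ?_) (fun k => ?_) h |>.congr fun p => ?_
  · rw [LinearMap.comp_apply, pairing_apply]
    refine (norm_circleInt_le _).trans ?_
    have h1 : ‖f * wave p.2‖ ≤ ‖f‖ := by
      refine (norm_mul_le _ _).trans ?_
      nlinarith [norm_nonneg f, norm_wave_le p.2]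
    calc 2 * π * ‖centeredDilate p.1 h * (f * wave p.2)‖
        ≤ 2 * π * ((2 * ‖h‖) * ‖f‖) := by
          gcongr
          refine (norm_mul_le _ _).trans ?_
          gcongr
          exact norm_centeredDilate_le _ _
      _ = _ := by ring
  · rcases eq_or_ne k 0 with rfl | hk
    · refine tendsto_const_nhds.congr fun p => ?_
      have hz : centeredDilate p.1 (fourier 0) = 0 := by
        ext x
        have h1 : 𝓘 (fourier 0) = 2 * π := by
          simp [circleInt_apply, volume_real_circle]
        have : (π : ℂ) ≠ 0 := by exact_mod_cast Real.pi_ne_zero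
        rw [centeredDilate_apply, h1]
        simp [dilate_apply]
        field_simp
        simp
      rw [LinearMap.comp_apply, hz, map_zero]
    · have hd : ∀ n, centeredDilate n (fourier k) = fourier (n * k) := by
        intro n
        rw [centeredDilate_apply, circleInt_fourier hk, dilate_fourier]; simp
      refine tendsto_zero_of_tendsto_fourier
        (fun p : ℕ × ℂ => pairing (fourier (p.1 * k) * wave p.2)) (2 * π) (fun p g => ?_)
        (fun m => ?_) f |>.congr fun p => ?_
      · refine norm_pairing_le ((norm_mul_le _ _).trans ?_) g
        rw [fourier_norm, one_mul]
        exact norm_wave_le _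
      · have hinj : Function.Injective fun n : ℕ => m + n * k := by
          intro a b hab
          have := mul_right_cancel₀ hk (add_left_cancel hab)
          exact_mod_cast this
        have ht : Tendsto (fun p : ℕ × ℂ => (m + p.1 * k, p.2)) (atTop ×ˢ ⊤)
            ((cofinite : Filter ℤ) ×ˢ (⊤ : Filter ℂ)) := by
          have h1 := hinj.tendsto_cofinite
          rw [Nat.cofinite_eq_atTop] at h1
          exact h1.prodMap tendsto_id
        refine (tendsto_osc_fourier_order.comp ht).congr fun p => ?_
        simp only [Function.comp, osc, pairing_apply, fourier_add_eq, mul_assoc]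
      · rw [LinearMap.comp_apply, hd, pairing_apply, pairing_apply]
        congr 1; ring
  · rw [LinearMap.comp_apply, pairing_apply, osc]
    congr 1; ring

/-- A real continuous function viewed as a complex one. -/
def complexify (f : C(𝕋, ℝ)) : C(𝕋, ℂ) := ⟨fun x => (f x : ℂ), by fun_prop⟩

theorem complexify_apply (f : C(𝕋, ℝ)) (x : 𝕋) : complexify f x = (f x : ℂ) := rfl

theorem circleInt_complexify (f : C(𝕋, ℝ)) : 𝓘 (complexify f) = ((∫ x, f x : ℝ) : ℂ) :=
  integral_ofReal

theorem osc_complexify_zero (f : C(𝕋, ℝ)) : osc (complexify f) 0 = ((∫ x, f x : ℝ) : ℂ) := by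
  rw [osc, wave_zero, mul_one, circleInt_complexify]

theorem osc_sub (f g : C(𝕋, ℂ)) (z : ℂ) : osc (f - g) z = osc f z - osc g z := by
  simp only [osc_eq_pairing, map_sub]

theorem osc_smul (c : ℂ) (f : C(𝕋, ℂ)) (z : ℂ) : osc (c • f) z = c * osc f z := by
  simp only [osc_eq_pairing, map_smul, smul_eq_mul]

theorem eventually_norm_osc_mul_dilate_sub_le (f h : C(𝕋, ℝ)) {m : ℝ}
    (hm : ∫ x, h x = 2 * π * m) {ε : ℝ} (hε : 0 < ε) :
    ∀ᶠ n : ℕ in atTop, ∀ z : ℂ,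
      ‖osc (complexify (f * dilate n h)) z - m * osc (complexify f) z‖ ≤ ε := by
  have H := Metric.tendsto_nhds.1 (tendsto_osc_centeredDilate (complexify f) (complexify h)) ε hε
  obtain ⟨pa, hpa, pb, hpb, H⟩ := eventually_prod_iff.1 H
  filter_upwards [hpa] with n hn z
  have hz := (H hn (eventually_top.1 hpb z)).le
  rw [dist_zero_right] at hz
  have heq : complexify f * centeredDilate n (complexify h) =
      complexify (f * dilate n h) - (m : ℂ) • complexify f := by
    have hc : (2 * π : ℂ)⁻¹ * 𝓘 (complexify h) = m := by
      have : (π : ℂ) ≠ 0 := by exact_mod_cast Real.pi_ne_zero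
      rw [circleInt_complexify, hm]
      push_cast
      field_simp
    ext x
    rw [centeredDilate_apply, hc]
    simp [complexify_apply, dilate_apply]
    ring
  rw [heq, osc_sub, osc_smul] at hz
  exact hz

/-! ### Caps and the lacunary product -/

/-- The cosine on the circle. -/
def circleCos : C(𝕋, ℝ) := ⟨fun x => (fourier 1 x : ℂ).re, by fun_prop⟩

theorem circleCos_coe (t : ℝ) : circleCos (t : 𝕋) = Real.cos t := by
  change (fourier 1 (t : 𝕋) : ℂ).re = _
  rw [fourier_coe_two_pi]
  simp [Complex.exp_ofReal_mul_I_re]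

theorem circleCos_zero : circleCos 0 = 1 := by
  have := circleCos_coe 0
  simpa using this

/-- A nonnegative continuous function, positive somewhere, rescaled to have integral `M`. -/
theorem exists_const_mul_integral_eq {f : C(𝕋, ℝ)} (hf : ∀ x, 0 ≤ f x) {y : 𝕋} (hy : f y ≠ 0)
    {M : ℝ} (hM : 0 < M) : ∃ c : ℝ, 0 < c ∧ ∫ x, c * f x = M := by
  have hpos : 0 < ∫ x, f x :=
    f.continuous.integral_pos_of_hasCompactSupport_nonneg_nonzero
      (HasCompactSupport.of_compactSpace _) hf hy
  refine ⟨M / ∫ x, f x, by positivity, ?_⟩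
  rw [integral_const_mul, div_mul_cancel₀ _ hpos.ne']

/-- The part of `f` above the level `a`. -/
def excess (f : C(𝕋, ℝ)) (a : ℝ) : C(𝕋, ℝ) := ⟨fun x => max 0 (f x - a), by fun_prop⟩

theorem excess_nonneg (f : C(𝕋, ℝ)) (a : ℝ) (x : 𝕋) : 0 ≤ excess f a x := le_max_left _ _

theorem excess_pos {f : C(𝕋, ℝ)} {a : ℝ} {x : 𝕋} (h : a < f x) : 0 < excess f a x :=
  lt_max_of_lt_right (sub_pos.2 h)

theorem le_of_excess_ne_zero {f : C(𝕋, ℝ)} {a : ℝ} {x : 𝕋} (h : excess f a x ≠ 0) : a ≤ f x := by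
  by_contra! hlt
  exact h (max_eq_left (sub_nonpos.2 hlt.le))

/-- Mean one makes multiplication by a high dilate almost preserve the Fourier transform, while the
support condition thins out the support. -/
theorem exists_cap_density : ∃ h : C(𝕋, ℝ), (∀ x, 0 ≤ h x) ∧ (∫ x, h x = 2 * π) ∧
    ∀ x, h x ≠ 0 → 1 / 2 ≤ circleCos x := by
  obtain ⟨c, hc, hint⟩ := exists_const_mul_integral_eq (excess_nonneg circleCos (1 / 2))
    (y := 0) (excess_pos (by rw [circleCos_zero]; norm_num)).ne' Real.two_pi_pos
  refine ⟨c • excess circleCos (1 / 2), fun x => mul_nonneg hc.le (excess_nonneg _ _ x), hint,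
    fun x hx => le_of_excess_ne_zero fun h0 => hx ?_⟩
  rw [ContinuousMap.smul_apply, h0, smul_zero]

/-- A majorant of the indicator function of `{cos ≥ 1/2}` with mean less than one. -/
def capMajorant : C(𝕋, ℝ) := ⟨fun x => (2 / 3 * (1 + circleCos x)) ^ 2, by fun_prop⟩

theorem capMajorant_nonneg (x : 𝕋) : 0 ≤ capMajorant x := sq_nonneg _

theorem one_le_capMajorant {x : 𝕋} (h : 1 / 2 ≤ circleCos x) : 1 ≤ capMajorant x :=
  -- The factor `2/3` is the inverse of `1 + 1/2`, so the majorant equals one exactly where `cos =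
  -- 1/2`.
  one_le_pow₀ (by linarith)

theorem integral_capMajorant : ∫ x, capMajorant x = 2 * π * (2 / 3) := by
  rw [integral_circle_eq]
  have : ∀ t : ℝ, capMajorant (t : 𝕋) =
      4 / 9 + 8 / 9 * Real.cos t + 4 / 9 * Real.cos t ^ 2 := by
    intro t
    change (2 / 3 * (1 + circleCos (t : 𝕋))) ^ 2 = _
    rw [circleCos_coe]; ring
  simp only [this]
  rw [intervalIntegral.integral_add (Continuous.intervalIntegrable (by fun_prop) _ _)
      (Continuous.intervalIntegrable (by fun_prop) _ _),
    intervalIntegral.integral_add (Continuous.intervalIntegrable (by fun_prop) _ _)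
      (Continuous.intervalIntegrable (by fun_prop) _ _),
    intervalIntegral.integral_const_mul, intervalIntegral.integral_const_mul, integral_cos_sq]
  simp
  ring

/-- A lacunary product of dilated caps: the Fourier transforms converge uniformly, and the
supports shrink geometrically. -/
theorem exists_lacunary_product (p₀ : C(𝕋, ℝ)) (hp₀ : ∀ x, 0 ≤ p₀ x) :
    ∃ (n : ℕ → ℕ) (p : ℕ → C(𝕋, ℝ)), p 0 = p₀ ∧ (∀ k x, 0 ≤ p k x) ∧
      (∀ k x, p k x ≠ 0 → p₀ x ≠ 0 ∧ ∀ i < k, 1 / 2 ≤ circleCos (n i • x)) ∧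
      (∀ k z, ‖osc (complexify (p (k + 1))) z - osc (complexify (p k)) z‖ ≤ (1 / 2) ^ k / 4) ∧
      ∀ k, volume.real {x : 𝕋 | ∀ i < k, 1 / 2 ≤ circleCos (n i • x)} ≤ 2 * π * (3 / 4) ^ k := by
  obtain ⟨h, h0, hint, hsupp⟩ := exists_cap_density
  -- The pair holds the density and a continuous majorant of the indicator of the shrinking set. A
  -- single `n` must serve both: the density keeps its transform, the majorant loses about a third
  -- of its integral.
  have step : ∀ (q : C(𝕋, ℝ) × C(𝕋, ℝ)) (k : ℕ), ∃ n : ℕ,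
      (∀ z, ‖osc (complexify (q.1 * dilate n h)) z - osc (complexify q.1) z‖ ≤ (1 / 2) ^ k / 4) ∧
      ∫ x, (q.2 * dilate n capMajorant) x ≤ 2 / 3 * (∫ x, q.2 x) + (1 / 2) ^ k / 4 := by
    intro q k
    have h1 := eventually_norm_osc_mul_dilate_sub_le q.1 h (m := 1) (by rw [hint, mul_one])
      (ε := (1 / 2) ^ k / 4) (by positivity)
    have h2 := eventually_norm_osc_mul_dilate_sub_le q.2 capMajorant integral_capMajorant
      (ε := (1 / 2) ^ k / 4) (by positivity)
    obtain ⟨n, hn1, hn2⟩ := (h1.and h2).exists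
    refine ⟨n, fun z => by simpa using hn1 z, ?_⟩
    -- At frequency zero the transform is the integral.
    have := hn2 0
    rw [osc_complexify_zero, osc_complexify_zero, ← Complex.ofReal_mul, ← Complex.ofReal_sub,
      Complex.norm_real] at this
    linarith [(abs_le.1 this).2]
  choose N hN1 hN2 using step
  let q : ℕ → C(𝕋, ℝ) × C(𝕋, ℝ) := fun k => Nat.rec (p₀, 1)
    (fun k q => (q.1 * dilate (N q k) h, q.2 * dilate (N q k) capMajorant)) k
  have hq : ∀ k, q (k + 1) = ((q k).1 * dilate (N (q k) k) h,
    (q k).2 * dilate (N (q k) k) capMajorant) := fun k => rfl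
  have hv0 : ∀ k x, 0 ≤ (q k).2 x := by
    intro k x
    induction k with
    | zero => exact zero_le_one
    | succ k ih => rw [hq]; exact mul_nonneg ih (capMajorant_nonneg _)
  have hv1 : ∀ k x, (∀ i < k, 1 / 2 ≤ circleCos (N (q i) i • x)) → 1 ≤ (q k).2 x := by
    intro k x
    induction k with
    | zero => exact fun _ => le_rfl
    | succ k ih =>
      intro hx
      rw [hq]
      exact one_le_mul_of_one_le_of_one_le (ih fun i hi => hx i (hi.trans k.lt_succ_self))
        (one_le_capMajorant (hx k k.lt_succ_self))
  have hvint : ∀ k, ∫ x, (q k).2 x ≤ 2 * π * (3 / 4) ^ k := by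
    intro k
    induction k with
    | zero =>
      have : ∫ x, (q 0).2 x = 2 * π := by
        change ∫ x : 𝕋, (1 : ℝ) = _
        simp [volume_real_circle]
      rw [this]; simp
    | succ k ih =>
      have h1 := hN2 (q k) k
      have h2 : ((1 : ℝ) / 2) ^ k ≤ (3 / 4) ^ k :=
        pow_le_pow_left₀ (by norm_num) (by norm_num) k
      have h3 : (0 : ℝ) < (3 / 4) ^ k := by positivity
      rw [hq, pow_succ]
      -- The slack `2π (3/4 - 2/3) = π/6` absorbs the error `1/4`.
      nlinarith [Real.pi_gt_three]
  refine ⟨fun k => N (q k) k, fun k => (q k).1, rfl, ?_, ?_, fun k z => hN1 (q k) k z, ?_⟩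
  · intro k x
    induction k with
    | zero => exact hp₀ x
    | succ k ih => simp only [hq]; exact mul_nonneg ih (h0 _)
  · intro k x
    induction k with
    | zero => exact fun hx => ⟨hx, fun i hi => absurd hi (Nat.not_lt_zero i)⟩
    | succ k ih =>
      intro hx
      simp only [hq, ContinuousMap.mul_apply] at hx
      obtain ⟨h1, h2⟩ := ih (left_ne_zero_of_mul hx)
      refine ⟨h1, fun i hi => ?_⟩
      rcases Nat.lt_succ_iff_lt_or_eq.1 hi with hi | rfl
      · exact h2 i hi
      · exact hsupp _ (right_ne_zero_of_mul hx)
  · intro k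
    refine le_trans ?_ (hvint k)
    have hm : MeasurableSet {x : 𝕋 | ∀ i < k, 1 / 2 ≤ circleCos (N (q i) i • x)} := by
      refine IsClosed.measurableSet ?_
      simp only [ofPred_forall]
      exact isClosed_iInter fun i => isClosed_iInter fun _ =>
        isClosed_le continuous_const (by fun_prop)
    rw [← integral_indicator_one hm]
    refine integral_mono ((integrable_const 1).indicator hm) (integrable_circle _) fun x => ?_
    by_cases hx : x ∈ {x : 𝕋 | ∀ i < k, 1 / 2 ≤ circleCos (N (q i) i • x)}
    · rw [indicator_of_mem hx]; exact hv1 k x hx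
    · rw [indicator_of_notMem hx]; exact hv0 k x

/-! ### Normalized densities and their weak limits -/

/-- The probability measure on the circle with density proportional to `p`. -/
theorem exists_probabilityMeasure_of_density {p : C(𝕋, ℝ)} (hp : ∀ x, 0 ≤ p x)
    (hM : 0 < ∫ x, p x) : ∃ μ : ProbabilityMeasure 𝕋,
      (∀ K : Set 𝕋, MeasurableSet K → (∀ x, p x ≠ 0 → x ∈ K) → (μ : Measure 𝕋) Kᶜ = 0) ∧
      ∀ z, ∫ x, wave z x ∂(μ : Measure 𝕋) = (∫ x, p x : ℝ)⁻¹ * osc (complexify p) z := by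
  set M := ∫ x, p x
  have hmeas : Measurable fun x => ENNReal.ofReal (M⁻¹ * p x) := by fun_prop
  have hnn : ∀ x, 0 ≤ M⁻¹ * p x := fun x => mul_nonneg (inv_nonneg.2 hM.le) (hp x)
  have hprob : IsProbabilityMeasure
      ((volume : Measure 𝕋).withDensity fun x => ENNReal.ofReal (M⁻¹ * p x)) := by
    refine ⟨?_⟩
    rw [withDensity_apply _ MeasurableSet.univ, Measure.restrict_univ,
      ← ofReal_integral_eq_lintegral_ofReal ((integrable_circle p).const_mul _)
        (Eventually.of_forall hnn), integral_const_mul, inv_mul_cancel₀ hM.ne', ENNReal.ofReal_one]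
  refine ⟨⟨_, hprob⟩, fun K hK hKp => ?_, fun z => ?_⟩
  · rw [ProbabilityMeasure.coe_mk, withDensity_apply _ hK.compl,
      setLIntegral_eq_zero_iff hK.compl hmeas]
    refine Eventually.of_forall fun x hx => ?_
    by_contra h
    refine hx (hKp x fun h0 => h ?_)
    simp [h0]
  · rw [ProbabilityMeasure.coe_mk, integral_withDensity_eq_integral_toReal_smul hmeas
      (Eventually.of_forall fun x => ENNReal.ofReal_lt_top), osc_apply, ← integral_const_mul]
    congr 1; ext x
    rw [ENNReal.toReal_ofReal (hnn x), Complex.real_smul, complexify_apply]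
    push_cast
    ring

/-- A weak limit of normalized densities. -/
theorem exists_limit_probabilityMeasure {p : ℕ → C(𝕋, ℝ)} (hp : ∀ k x, 0 ≤ p k x) {M : ℝ}
    (hM : 0 < M) (hpM : ∀ k, M ≤ ∫ x, p k x) :
    ∃ μ : ProbabilityMeasure 𝕋,
      (∀ (K : Set 𝕋) (j : ℕ), IsClosed K → (∀ k ≥ j, ∀ x, p k x ≠ 0 → x ∈ K) →
        (μ : Measure 𝕋) Kᶜ = 0) ∧
      ∀ (z : ℂ) (b : ℝ) (j : ℕ), (∀ k ≥ j, ‖osc (complexify (p k)) z‖ ≤ b) →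
        ‖∫ x, wave z x ∂(μ : Measure 𝕋)‖ ≤ M⁻¹ * b := by
  choose ν hν1 hν2 using fun k =>
    exists_probabilityMeasure_of_density (hp k) (hM.trans_le (hpM k))
  -- The probability measures on the compact circle form a compact space; a limit along an
  -- ultrafilter replaces a convergent subsequence.
  obtain ⟨μ, hlim⟩ : ∃ μ, Tendsto ν (hyperfilter ℕ) (𝓝 μ) :=
    ⟨_, (Ultrafilter.map ν (hyperfilter ℕ)).le_nhds_lim⟩
  have hlarge : ∀ j, ∀ᶠ k in (hyperfilter ℕ : Filter ℕ), j ≤ k := fun j =>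
    Nat.hyperfilter_le_atTop (eventually_ge_atTop j)
  refine ⟨μ, fun K j hK hKp => ?_, fun z b j hb => ?_⟩
  -- Portmanteau: the open set `Kᶜ` has limit mass at most the liminf of masses that are eventually
  -- zero.
  · have h1 := ProbabilityMeasure.le_liminf_measure_open_of_tendsto hlim hK.isOpen_compl
    refine le_antisymm (h1.trans ?_) bot_le
    have h2 : ∀ᶠ k in (hyperfilter ℕ : Filter ℕ), (ν k : Measure 𝕋) Kᶜ = 0 :=
      (hlarge j).mono fun k hk => hν1 k K hK.measurableSet (hKp k hk)
    rw [liminf_congr h2, liminf_const]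
  · have h1 := (ProbabilityMeasure.tendsto_iff_forall_integral_rclike_tendsto ℂ).1 hlim
      (BoundedContinuousFunction.mkOfCompact (wave z))
    refine le_of_tendsto h1.norm ((hlarge j).mono fun k hk => ?_)
    simp only [BoundedContinuousFunction.mkOfCompact_apply]
    rw [hν2, norm_mul, Complex.norm_real, Real.norm_eq_abs,
      abs_of_pos (inv_pos.2 (hM.trans_le (hpM k)))]
    gcongr
    · exact hpM k
    · exact hb k hk

/-! ### Transfer to the unit circle of the plane -/

/-- The parametrization of the unit circle of the plane by `ℝ / 2πℤ`. -/
def circleEmbedding (x : 𝕋) : Plane := !₂[(fourier 1 x : ℂ).re, (fourier 1 x : ℂ).im]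

theorem continuous_circleEmbedding : Continuous circleEmbedding := by
  unfold circleEmbedding
  refine (PiLp.continuous_toLp 2 _).comp (continuous_pi fun i => ?_)
  fin_cases i
  · exact Complex.continuous_re.comp (fourier 1).continuous
  · exact Complex.continuous_im.comp (fourier 1).continuous

theorem circleEmbedding_coe (t : ℝ) : circleEmbedding (t : 𝕋) = circlePoint t := by
  rw [circleEmbedding, circlePoint, fourier_coe_two_pi]
  simp [Complex.exp_ofReal_mul_I_re, Complex.exp_ofReal_mul_I_im]

theorem injective_circleEmbedding : Function.Injective circleEmbedding := by
  intro x y h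
  have h0 : (fourier 1 x : ℂ).re = (fourier 1 y : ℂ).re := congrArg (fun v : Plane => v 0) h
  have h1 : (fourier 1 x : ℂ).im = (fourier 1 y : ℂ).im := congrArg (fun v : Plane => v 1) h
  have h2 := Complex.ext h0 h1
  rw [fourier_one, fourier_one] at h2
  exact AddCircle.injective_toCircle Real.two_pi_pos.ne' (Circle.ext h2)

theorem arcLength_image {K : Set 𝕋} (hK : IsClosed K) :
    arcLength (circleEmbedding '' K) = volume K := by
  have hc : IsClosed (circleEmbedding '' K) :=
    (hK.isCompact.image continuous_circleEmbedding).isClosed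
  rw [arcLength, Measure.map_apply continuous_circlePoint.measurable hc.measurableSet,
    restrict_Ico_eq_restrict_Ioc]
  have hmp := AddCircle.measurePreserving_mk (2 * π) 0
  rw [zero_add] at hmp
  rw [← hmp.measure_preimage hK.measurableSet.nullMeasurableSet]
  congr 1
  ext t
  rw [mem_preimage, mem_preimage, ← circleEmbedding_coe, injective_circleEmbedding.mem_set_image]

/-- The frequency on the circle corresponding to a frequency in the plane. -/
def planeFrequency (ξ : Plane) : ℂ := -2 * π * (ξ 0 - ξ 1 * Complex.I)

theorem norm_planeFrequency (ξ : Plane) : ‖planeFrequency ξ‖ = 2 * π * ‖ξ‖ := by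
  have h : ‖(ξ 0 - ξ 1 * Complex.I : ℂ)‖ = ‖ξ‖ := by
    rw [Complex.norm_def, Complex.normSq_apply, EuclideanSpace.norm_eq, Fin.sum_univ_two]
    simp [sq]
  rw [planeFrequency, norm_mul, h]
  simp [abs_of_pos Real.pi_pos]

theorem tendsto_planeFrequency :
    Tendsto planeFrequency (Bornology.cobounded Plane) (Bornology.cobounded ℂ) := by
  rw [← tendsto_norm_atTop_iff_cobounded]
  simp only [norm_planeFrequency]
  exact tendsto_norm_cobounded_atTop.const_mul_atTop Real.two_pi_pos

/-- The conjugate in `planeFrequency` is there because `Re ((ξ₀ - i ξ₁) e^{ix})` is the inner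
product of `ξ` with the point of angle `x`. -/
theorem measureFourier_map (μ : Measure 𝕋) (ξ : Plane) :
    measureFourier (μ.map circleEmbedding) ξ = ∫ x, wave (planeFrequency ξ) x ∂μ := by
  rw [measureFourier, integral_map continuous_circleEmbedding.aemeasurable
    (Continuous.aestronglyMeasurable (by fun_prop))]
  congr 1; ext x
  rw [wave_apply]
  congr 1
  have h1 : inner ℝ ξ (circleEmbedding x) =
      ξ 0 * (fourier 1 x : ℂ).re + ξ 1 * (fourier 1 x : ℂ).im := by
    simp only [PiLp.inner_apply, Fin.sum_univ_two, circleEmbedding]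
    simp [mul_comm]
  have h2 : (planeFrequency ξ * fourier 1 x).re =
      -2 * π * (ξ 0 * (fourier 1 x : ℂ).re + ξ 1 * (fourier 1 x : ℂ).im) := by
    simp [planeFrequency, -fourier_apply, Complex.mul_re]
    ring
  rw [h1, h2]
  push_cast
  ring

/-! ### Construction of the measure on a null set -/

theorem exists_rajchman_null_subset {p₀ : C(𝕋, ℝ)} (hp₀ : ∀ x, 0 ≤ p₀ x) (hint : ∫ x, p₀ x = 1)
    {B : Set 𝕋} (hB : IsClosed B) (hsupp : ∀ x, p₀ x ≠ 0 → x ∈ B) :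
    ∃ K ⊆ B, IsClosed K ∧ volume K = 0 ∧ ∃ μ : Measure 𝕋, IsProbabilityMeasure μ ∧ μ Kᶜ = 0 ∧
      Tendsto (fun z => ∫ x, wave z x ∂μ) (Bornology.cobounded ℂ) (𝓝 0) := by
  obtain ⟨n, p, h0, hp, hps, hosc, hvol⟩ := exists_lacunary_product p₀ hp₀
  let L : ℕ → Set 𝕋 := fun k => {x : 𝕋 | ∀ i < k, 1 / 2 ≤ circleCos (n i • x)}
  have hL : ∀ k, IsClosed (L k) := by
    intro k
    simp only [L, ofPred_forall]
    exact isClosed_iInter fun i => isClosed_iInter fun _ =>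
      isClosed_le continuous_const (by fun_prop)
  -- The right side is the exact geometric sum of the errors `(1/2)^i / 4` over `j ≤ i < k`.
  have hdist : ∀ (z : ℂ) (j k : ℕ), j ≤ k →
      ‖osc (complexify (p k)) z - osc (complexify (p j)) z‖ ≤ (1 / 2) ^ j / 2 - (1 / 2) ^ k / 2 := by
    intro z j k hjk
    induction k, hjk using Nat.le_induction with
    | base => simp
    | succ k hk ih =>
      have h1 := hosc k z
      have h2 := norm_sub_le_norm_sub_add_norm_sub (osc (complexify (p (k + 1))) z)
        (osc (complexify (p k)) z) (osc (complexify (p j)) z)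
      rw [pow_succ]
      linarith
  -- At frequency zero the errors total less than `1/2`, so the initial mass one cannot drop below
  -- `1/2`; normalization then costs at most a factor two.
  have hmass : ∀ k, 1 / 2 ≤ ∫ x, p k x := by
    intro k
    have h1 := hdist 0 0 k (Nat.zero_le k)
    rw [osc_complexify_zero, osc_complexify_zero, h0, hint, ← Complex.ofReal_sub,
      Complex.norm_real] at h1
    have h2 : (0 : ℝ) < (1 / 2) ^ k := by positivity
    rw [pow_zero] at h1
    linarith [(abs_le.1 h1).1]
  obtain ⟨μ, hμ1, hμ2⟩ := exists_limit_probabilityMeasure hp (by norm_num : (0 : ℝ) < 1 / 2) hmass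
  refine ⟨B ∩ ⋂ k, L k, inter_subset_left, hB.inter (isClosed_iInter hL), ?_, μ, inferInstance,
    ?_, ?_⟩
  · have hlim : Tendsto (fun k : ℕ => 2 * π * ((3 : ℝ) / 4) ^ k) atTop (𝓝 0) := by
      simpa using (tendsto_pow_atTop_nhds_zero_of_lt_one (by norm_num : (0 : ℝ) ≤ 3 / 4)
        (by norm_num)).const_mul (2 * π)
    have h1 : volume.real (B ∩ ⋂ k, L k) ≤ 0 := by
      refine ge_of_tendsto' hlim fun k => le_trans ?_ (hvol k)
      exact measureReal_mono (inter_subset_right.trans (iInter_subset _ k))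
    exact (measureReal_eq_zero_iff).1 (le_antisymm h1 measureReal_nonneg)
  · rw [compl_inter, compl_iInter]
    -- All the densities vanish off `B`, but only those with index `k ≥ j` are sure to vanish off `L
    -- j`.
    refine measure_union_null (hμ1 B 0 hB fun k _ x hx => hsupp x (hps k x hx).1)
      (measure_iUnion_null fun j => hμ1 (L j) j (hL j) fun k hk x hx i hi =>
        (hps k x hx).2 i (hi.trans_le hk))
  · rw [Metric.tendsto_nhds]
    intro ε hε
    obtain ⟨j, hj⟩ := exists_pow_lt_of_lt_one (show 0 < ε / 4 by positivity)
      (show (1 / 2 : ℝ) < 1 by norm_num)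
    filter_upwards [Metric.tendsto_nhds.1 (tendsto_osc (complexify (p j))) (ε / 4)
      (by positivity)] with z hz
    rw [dist_zero_right] at hz ⊢
    -- `ε/4` bounds the transform of `p j`, `ε/8` the later changes; doubling gives `3ε/4`.
    refine (hμ2 z (ε / 4 + ε / 8) j fun k hk => ?_).trans_lt ?_
    · have h1 := hdist z j k hk
      have h2 : (0 : ℝ) < (1 / 2) ^ k := by positivity
      have h3 := norm_le_norm_add_norm_sub' (osc (complexify (p k)) z) (osc (complexify (p j)) z)
      linarith
    · linarith

/-- The bump is a multiple of the positive part of `cos (x - c) - cos δ`; cosine decreases on `[0,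
π]`, so the support lies within `δ` of `c`. -/
theorem exists_bump_density (c : ℝ) {δ : ℝ} (hδ : 0 < δ) (hδπ : δ ≤ π) :
    ∃ p : C(𝕋, ℝ), (∀ x, 0 ≤ p x) ∧ (∫ x, p x = 1) ∧
      ∀ x, p x ≠ 0 → x ∈ (fun t : ℝ => (t : 𝕋)) '' Icc (c - δ) (c + δ) := by
  set f : C(𝕋, ℝ) := circleCos.comp ⟨fun x => x - (c : 𝕋), by fun_prop⟩ with hf
  have hfc : ∀ x, f x = circleCos (x - (c : 𝕋)) := fun x => rfl
  obtain ⟨a, ha, hint⟩ := exists_const_mul_integral_eq (excess_nonneg f (Real.cos δ))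
    (y := (c : 𝕋)) (excess_pos (by
      rw [hfc, sub_self, circleCos_zero, ← Real.cos_zero]
      exact Real.cos_lt_cos_of_nonneg_of_le_pi le_rfl hδπ hδ)).ne' one_pos
  refine ⟨a • excess f (Real.cos δ), fun x => mul_nonneg ha.le (excess_nonneg _ _ x), hint,
    fun x hx => ?_⟩
  have hle : Real.cos δ ≤ f x := le_of_excess_ne_zero fun h0 => hx (by
    rw [ContinuousMap.smul_apply, h0, smul_zero])
  obtain ⟨t, ht, rfl⟩ : ∃ t ∈ Ioc (c - π) (c - π + 2 * π), (t : 𝕋) = x :=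
    ⟨_, (AddCircle.equivIoc (2 * π) (c - π) x).2, AddCircle.coe_equivIoc⟩
  refine ⟨t, ?_, rfl⟩
  rw [hfc, ← AddCircle.coe_sub, circleCos_coe, ← Real.cos_abs (t - c)] at hle
  have habs : |t - c| ≤ π := abs_le.2 ⟨by linarith [ht.1], by linarith [ht.2]⟩
  have hd : |t - c| ≤ δ := by
    by_contra! hlt
    exact absurd (Real.cos_lt_cos_of_nonneg_of_le_pi hδ.le habs hlt) (not_lt.2 hle)
  exact ⟨by linarith [(abs_le.1 hd).1], by linarith [(abs_le.1 hd).2]⟩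

end

theorem theorem7p1 (A : Set Plane) (hA : IsArc A) :
    ∃ Θ : Set Plane, IsClosed Θ ∧ Θ ⊆ A ∧ arcLength Θ = 0 ∧
      ∃ σ : Measure Plane, IsProbabilityMeasure σ ∧ σ Θᶜ = 0 ∧
        Tendsto (measureFourier σ) (Bornology.cobounded Plane) (𝓝 0) := by
  obtain ⟨I, hI, hnt, rfl⟩ := hA
  obtain ⟨a, ha, b, hb, hab⟩ := hnt.exists_lt
  -- The first bound keeps the bump between `a` and `b`; the second keeps `δ` where cosine is
  -- monotone, even if the interval winds around the circle.
  set δ := min ((b - a) / 2) π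
  have hδ : 0 < δ := lt_min (by linarith) Real.pi_pos
  have hδ' : δ ≤ (b - a) / 2 := min_le_left _ _
  obtain ⟨p, hp, hint, hsupp⟩ := exists_bump_density ((a + b) / 2) hδ (min_le_right _ _)
  obtain ⟨K, hKB, hK, hK0, μ, hμ, hμK, hlim⟩ := exists_rajchman_null_subset hp hint
    (isCompact_Icc.image (AddCircle.continuous_mk' (2 * π))).isClosed hsupp
  have hΘ : IsClosed (circleEmbedding '' K) :=
    (hK.isCompact.image continuous_circleEmbedding).isClosed
  refine ⟨circleEmbedding '' K, hΘ, ?_, by rw [arcLength_image hK, hK0],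
    μ.map circleEmbedding,
    Measure.isProbabilityMeasure_map continuous_circleEmbedding.aemeasurable, ?_, ?_⟩
  · rintro _ ⟨x, hx, rfl⟩
    obtain ⟨t, ht, rfl⟩ := hKB hx
    exact ⟨t, hI.out ha hb ⟨by linarith [ht.1], by linarith [ht.2]⟩, (circleEmbedding_coe t).symm⟩
  · rw [Measure.map_apply continuous_circleEmbedding.measurable hΘ.isOpen_compl.measurableSet]
    exact measure_mono_null (fun x hx hxK => hx ⟨x, hxK, rfl⟩) hμK
  · exact (hlim.comp tendsto_planeFrequency).congr fun ξ => (measureFourier_map μ ξ).symm
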